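/- **Theorem 4.1.** Every unital separable simple TAI $C^*$-algebra is an MF-algebra in the sense of Blackadar–Kirchberg. Here the notions are as follows. *Comparison.* Projections $p,q$ in a $C^*$-algebra $A$ are equivalent if $p=v^*v$ and $q=vv^*$ for some $v\in A$. Write $p\preceq q$ if $p$ is equivalent to a projection in $qAq$. For $a\in A_+$, write $p\preceq a$ if $p\preceq q$ for some projection $q\in\overline{aAa}$. Write $n[p]\le[q]$ if $qAq$ contains $n$ mutually orthogonal projections, each equivalent to $p$. An element is full if the closed two-sided ideal it generates is $A$. $A$ is simple if $A\neq 0$ and its only closed two-sided ideals are $0$ and $A$. *TAI.* Let $\mathcal I$ be the class of $C^*$-algebras isomorphic to finite direct sums of algebras of the form $M_k(\mathbb C)$ or $M_k(C([0,1]))$. A unital $C^*$-algebra $A$ is *tracially approximately interval* (TAI) if for every finite subset $\mathcal F\subset A$ containing a nonzero element $b$, every $\varepsilon>0$, every integer $n>0$ and every full element $a\in A_+$ there exist a nonzero projection $p\in A$ and a $C^*$-subalgebra $I\subset A$ with $I\in\mathcal I$ and $1_I=p$ such that 1. $\|xp-px\|<\varepsilon$ for all $x\in\mathcal F$; 2.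 for every $x\in\mathcal F$ there is $y\in I$ with $\|pxp-y\|<\varepsilon$, and $\|pbp\|\ge\|b\|-\varepsilon$; 3. $n[1-p]\le[p]$ and $1-p\preceq a$. *MF.* A generalized inductive system of $C^*$-algebras is a sequence $(A_n)$ of $C^*$-algebras with maps $\varphi_{m,n}:A_m\to A_n$ for $m<n$ (not assumed linear or continuous) such that $\varphi_{m,n}\circ\varphi_{k,m}=\varphi_{k,n}$ for $k<m<n$ and such that for all $k$, $x,y\in A_k$, $\lambda\in\mathbb C$ and $\varepsilon>0$ there is $M$ such that for all $m,n$ with $k<m<n$ and $M\le m$ the elements $\varphi_{m,n}(\varphi_{k,m}(x)+\varphi_{k,m}(y))-(\varphi_{k,n}(x)+\varphi_{k,n}(y))$, $\ \varphi_{m,n}(\lambda\varphi_{k,m}(x))-\lambda\varphi_{k,n}(x)$, $\ \varphi_{m,n}(\varphi_{k,m}(x)^*)-\varphi_{k,n}(x)^*$, $\ \varphi_{m,n}(\varphi_{k,m}(x)\varphi_{k,m}(y))-\varphi_{k,n}(x)\varphi_{k,n}(y)$ all have norm less than $\varepsilon$, and $\sup_{r>k}\|\varphi_{k,r}(x)\|<\infty$.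 Let $\varphi_k(x)$ be the class of the sequence $(\varphi_{k,n}(x))_{n>k}$ (with zero entries for $n\le k$) in $\prod_n A_n/\bigoplus_n A_n$, where $\prod_n A_n$ consists of the bounded sequences and $\bigoplus_n A_n$ of those whose norms tend to $0$. The limit of the system is the $C^*$-subalgebra $\overline{\bigcup_k\varphi_k(A_k)}$ of $\prod_n A_n/\bigoplus_n A_n$. A separable $C^*$-algebra is an *MF-algebra* if it is $*$-isomorphic to the limit of a generalized inductive system of finite-dimensional $C^*$-algebras. -/

import Mathlib

open scoped ENNReal

/-! ### Projections and comparison -/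

section Comparison

variable {A : Type*} [CStarAlgebra A]

/-- Murray–von Neumann equivalence of `p` and `q`: `p = v⋆v` and `q = vv⋆` for some `v`. -/
def MvNEquiv (p q : A) : Prop :=
  ∃ v : A, star v * v = p ∧ v * star v = q

/-- For projections, `p ⪯ q`: `p` is equivalent to a projection in `qAq`. -/
def MvNSub (p q : A) : Prop :=
  ∃ r : A, IsStarProjection r ∧ (∃ x : A, r = q * x * q) ∧ MvNEquiv p r

/-- `p ⪯ a` for a projection `p` and a positive element `a`: there is a projection `q` in the
hereditary subalgebra `closure (aAa)` with `p ⪯ q`. -/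
def MvNSubPositive (p a : A) : Prop :=
  ∃ q : A, IsStarProjection q ∧ q ∈ closure {y : A | ∃ x : A, y = a * x * a} ∧ MvNSub p q

/-- `n[p] ≤ [q]` for projections `p`, `q`: there are `n` mutually orthogonal projections in `qAq`,
each of them equivalent to `p`. -/
def MvNMultipleLe (n : ℕ) (p q : A) : Prop :=
  ∃ r : Fin n → A, (∀ i, IsStarProjection (r i) ∧ (∃ x : A, r i = q * x * q) ∧ MvNEquiv p (r i)) ∧
    ∀ i j, i ≠ j → r i * r j = 0

/-- An element is full if the closed two-sided ideal it generates is the whole algebra. -/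
def IsFullElement (a : A) : Prop :=
  closure ((TwoSidedIdeal.span {a} : TwoSidedIdeal A) : Set A) = Set.univ

variable (A) in
/-- A (unital) C⋆-algebra is simple if it is nonzero and its only closed two-sided ideals are `0`
and the algebra itself. -/
def IsSimpleCStarAlgebra : Prop :=
  Nontrivial A ∧ ∀ J : TwoSidedIdeal A, IsClosed (J : Set A) → J = ⊥ ∨ J = ⊤

end Comparison

/-! ### Tracially approximately interval algebras -/

/-- The finite direct sum of the matrix algebras `M_{k i}(ℂ)`, `i < m`, and of the algebras
`M_{l j}(C([0,1]))`, `j < n`. -/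
abbrev IntervalModel {m n : ℕ} (k : Fin m → ℕ) (l : Fin n → ℕ) : Type :=
  ((i : Fin m) → Matrix (Fin (k i)) (Fin (k i)) ℂ) ×
    ((j : Fin n) → Matrix (Fin (l j)) (Fin (l j)) C(unitInterval, ℂ))

/-- The C⋆-subalgebra `I` of `A` (not necessarily containing the unit of `A`) belongs to the class
of C⋆-algebras isomorphic to finite direct sums of algebras `M_k(ℂ)` and `M_k(C([0,1]))`.
An isomorphism of the underlying ⋆-algebras is automatically isometric. -/
def IsIntervalSubalgebra {A : Type*} [CStarAlgebra A] (I : NonUnitalStarSubalgebra ℂ A) : Prop :=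
  IsClosed (I : Set A) ∧
    ∃ (m n : ℕ) (k : Fin m → ℕ) (l : Fin n → ℕ), (∀ i, 0 < k i) ∧ (∀ j, 0 < l j) ∧
      Nonempty (I ≃⋆ₐ[ℂ] IntervalModel k l)

/-- A unital C⋆-algebra is tracially approximately interval (TAI). -/
def IsTAI (A : Type*) [CStarAlgebra A] [PartialOrder A] [StarOrderedRing A] : Prop :=
  ∀ (F : Finset A) (b : A), b ∈ F → b ≠ 0 → ∀ ε : ℝ, 0 < ε → ∀ n : ℕ, 0 < n →
    ∀ a : A, 0 ≤ a → IsFullElement a →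
      ∃ (p : A) (I : NonUnitalStarSubalgebra ℂ A),
        IsStarProjection p ∧ p ≠ 0 ∧ IsIntervalSubalgebra I ∧
        -- `p` is the unit of `I`
        (p ∈ I ∧ ∀ y ∈ I, p * y = y ∧ y * p = y) ∧
        (∀ x ∈ F, ‖x * p - p * x‖ < ε) ∧
        (∀ x ∈ F, ∃ y ∈ I, ‖p * x * p - y‖ < ε) ∧
        ‖b‖ - ε ≤ ‖p * b * p‖ ∧
        MvNMultipleLe n (1 - p) p ∧
        MvNSubPositive (1 - p) a

/-! ### The quotient `∏ Aₙ / ⨁ Aₙ` -/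

section Corona

variable (A : ℕ → Type*) [∀ n, NonUnitalCStarAlgebra (A n)]

/-- The `c₀`-direct sum `⨁ Aₙ` inside the full C⋆-direct product `∏ Aₙ` (bounded sequences with
the supremum norm). -/
def c0Sum : Submodule ℂ (lp A ∞) where
  carrier := {x | Filter.Tendsto (fun n => ‖x n‖) Filter.atTop (nhds 0)}
  zero_mem' := by simp
  add_mem' {x y} hx hy := by
    refine squeeze_zero (fun n => norm_nonneg _) (fun n => norm_add_le (x n) (y n)) ?_
    simpa using Filter.Tendsto.add hx hy
  smul_mem' c x hx := by
    have h : Filter.Tendsto (fun n => ‖c‖ * ‖x n‖) Filter.atTop (nhds (‖c‖ * 0)) :=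
      Filter.Tendsto.const_mul ‖c‖ hx
    simpa [norm_smul] using h

/-- The quotient `∏ Aₙ / ⨁ Aₙ`, with the quotient norm (instances below). -/
def Corona : Type _ := lp A ∞ ⧸ c0Sum A

noncomputable instance : SeminormedAddCommGroup (Corona A) :=
  inferInstanceAs (SeminormedAddCommGroup (lp A ∞ ⧸ c0Sum A))

noncomputable instance : Module ℂ (Corona A) :=
  inferInstanceAs (Module ℂ (lp A ∞ ⧸ c0Sum A))

variable {A}

/-- The quotient map `∏ Aₙ → ∏ Aₙ / ⨁ Aₙ`. -/
noncomputable def Corona.mk : lp A ∞ →ₗ[ℂ] Corona A := (c0Sum A).mkQ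

theorem Corona.mk_surjective : Function.Surjective (Corona.mk (A := A)) :=
  (c0Sum A).mkQ_surjective

theorem c0Sum.mul_left_mem (x : lp A ∞) {y : lp A ∞} (hy : y ∈ c0Sum A) : x * y ∈ c0Sum A := by
  have h : Filter.Tendsto (fun n => ‖x‖ * ‖y n‖) Filter.atTop (nhds (‖x‖ * 0)) :=
    Filter.Tendsto.const_mul ‖x‖ hy
  rw [mul_zero] at h
  refine squeeze_zero (fun n => norm_nonneg _) (fun n => ?_) h
  exact (norm_mul_le (x n) (y n)).trans
    (mul_le_mul_of_nonneg_right (lp.norm_apply_le_norm (by simp) x n) (norm_nonneg _))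

theorem c0Sum.star_mem {x : lp A ∞} (hx : x ∈ c0Sum A) : star x ∈ c0Sum A := by
  change Filter.Tendsto (fun n => ‖star (x n)‖) Filter.atTop (nhds 0)
  simp only [norm_star]
  exact hx

theorem c0Sum.mul_right_mem {x : lp A ∞} (y : lp A ∞) (hx : x ∈ c0Sum A) : x * y ∈ c0Sum A := by
  have h := c0Sum.star_mem (c0Sum.mul_left_mem (star y) (c0Sum.star_mem hx))
  simpa using h

noncomputable instance : Mul (Corona A) where
  mul := Quotient.map₂ (· * ·) (by
    intro x x' hx y y' hy
    refine (Submodule.quotientRel_def _).mpr ?_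
    replace hx := (Submodule.quotientRel_def _).mp hx
    replace hy := (Submodule.quotientRel_def _).mp hy
    have h := (c0Sum A).add_mem (c0Sum.mul_right_mem y hx) (c0Sum.mul_left_mem x' hy)
    rw [sub_mul, mul_sub] at h
    simpa using h)

noncomputable instance : Star (Corona A) where
  star := Quotient.map star (by
    intro x x' hx
    refine (Submodule.quotientRel_def _).mpr ?_
    replace hx := (Submodule.quotientRel_def _).mp hx
    simpa using c0Sum.star_mem hx)

theorem Corona.mk_mul (x y : lp A ∞) : Corona.mk (x * y) = Corona.mk x * Corona.mk y := rfl

theorem Corona.mk_star (x : lp A ∞) : Corona.mk (star x) = star (Corona.mk x) := rfl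

noncomputable instance : NonUnitalRing (Corona A) where
  __ := (inferInstance : AddCommGroup (Corona A))
  left_distrib a b c := by
    obtain ⟨a, rfl⟩ := Corona.mk_surjective a
    obtain ⟨b, rfl⟩ := Corona.mk_surjective b
    obtain ⟨c, rfl⟩ := Corona.mk_surjective c
    change Corona.mk a * (Corona.mk b + Corona.mk c)
      = Corona.mk a * Corona.mk b + Corona.mk a * Corona.mk c
    rw [← map_add, ← Corona.mk_mul, mul_add, map_add, Corona.mk_mul, Corona.mk_mul]
  right_distrib a b c := by
    obtain ⟨a, rfl⟩ := Corona.mk_surjective a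
    obtain ⟨b, rfl⟩ := Corona.mk_surjective b
    obtain ⟨c, rfl⟩ := Corona.mk_surjective c
    change (Corona.mk a + Corona.mk b) * Corona.mk c
      = Corona.mk a * Corona.mk c + Corona.mk b * Corona.mk c
    rw [← map_add, ← Corona.mk_mul, add_mul, map_add, Corona.mk_mul, Corona.mk_mul]
  zero_mul a := by
    obtain ⟨a, rfl⟩ := Corona.mk_surjective a
    change (0 : Corona A) * Corona.mk a = 0
    rw [← map_zero (Corona.mk (A := A)), ← Corona.mk_mul, zero_mul]
  mul_zero a := by
    obtain ⟨a, rfl⟩ := Corona.mk_surjective a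
    change Corona.mk a * (0 : Corona A) = 0
    rw [← map_zero (Corona.mk (A := A)), ← Corona.mk_mul, mul_zero]
  mul_assoc a b c := by
    obtain ⟨a, rfl⟩ := Corona.mk_surjective a
    obtain ⟨b, rfl⟩ := Corona.mk_surjective b
    obtain ⟨c, rfl⟩ := Corona.mk_surjective c
    rw [← Corona.mk_mul, ← Corona.mk_mul, ← Corona.mk_mul, ← Corona.mk_mul, mul_assoc]

noncomputable instance : StarRing (Corona A) where
  star_involutive a := by
    obtain ⟨a, rfl⟩ := Corona.mk_surjective a
    rw [← Corona.mk_star, ← Corona.mk_star, star_star]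
  star_mul a b := by
    obtain ⟨a, rfl⟩ := Corona.mk_surjective a
    obtain ⟨b, rfl⟩ := Corona.mk_surjective b
    rw [← Corona.mk_mul, ← Corona.mk_star, star_mul, Corona.mk_mul, Corona.mk_star, Corona.mk_star]
  star_add a b := by
    obtain ⟨a, rfl⟩ := Corona.mk_surjective a
    obtain ⟨b, rfl⟩ := Corona.mk_surjective b
    rw [← map_add, ← Corona.mk_star, star_add, map_add, Corona.mk_star, Corona.mk_star]

end Corona

/-! ### Generalized inductive limits and MF-algebras -/

/-- A generalized inductive system of C⋆-algebras (Blackadar–Kirchberg): a sequence of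
C⋆-algebras with coherent maps (not assumed linear or continuous) that are asymptotically linear,
⋆-preserving and multiplicative, and pointwise bounded. -/
structure GeneralizedInductiveSystem (A : ℕ → Type*) [∀ n, NonUnitalCStarAlgebra (A n)] where
  /-- The connecting map `A m → A n` for `m < n`. -/
  map : ∀ {m n : ℕ}, m < n → A m → A n
  coherent : ∀ {k m n : ℕ} (hkm : k < m) (hmn : m < n) (x : A k),
    map hmn (map hkm x) = map (hkm.trans hmn) x
  asymp_add : ∀ (k : ℕ) (x y : A k) (ε : ℝ), 0 < ε → ∃ M : ℕ,
    ∀ (m n : ℕ) (hkm : k < m) (hmn : m < n), M ≤ m →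
      ‖map hmn (map hkm x + map hkm y) -
        (map (hkm.trans hmn) x + map (hkm.trans hmn) y)‖ < ε
  asymp_smul : ∀ (k : ℕ) (c : ℂ) (x : A k) (ε : ℝ), 0 < ε → ∃ M : ℕ,
    ∀ (m n : ℕ) (hkm : k < m) (hmn : m < n), M ≤ m →
      ‖map hmn (c • map hkm x) - c • map (hkm.trans hmn) x‖ < ε
  asymp_star : ∀ (k : ℕ) (x : A k) (ε : ℝ), 0 < ε → ∃ M : ℕ,
    ∀ (m n : ℕ) (hkm : k < m) (hmn : m < n), M ≤ m →
      ‖map hmn (star (map hkm x)) - star (map (hkm.trans hmn) x)‖ < ε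
  asymp_mul : ∀ (k : ℕ) (x y : A k) (ε : ℝ), 0 < ε → ∃ M : ℕ,
    ∀ (m n : ℕ) (hkm : k < m) (hmn : m < n), M ≤ m →
      ‖map hmn (map hkm x * map hkm y) -
        map (hkm.trans hmn) x * map (hkm.trans hmn) y‖ < ε
  bounded : ∀ (k : ℕ) (x : A k), ∃ C : ℝ, ∀ (r : ℕ) (hkr : k < r), ‖map hkr x‖ ≤ C

namespace GeneralizedInductiveSystem

variable {A : ℕ → Type*} [∀ n, NonUnitalCStarAlgebra (A n)] (S : GeneralizedInductiveSystem A)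

/-- The bounded sequence `(φ_{k,n}(x))ₙ` attached to `x ∈ A k`, with zero entries for `n ≤ k`. -/
def toProd (k : ℕ) (x : A k) : lp A ∞ :=
  ⟨fun n => if h : k < n then S.map h x else 0, by
    obtain ⟨C, hC⟩ := S.bounded k x
    refine memℓp_infty ⟨max C 0, ?_⟩
    rintro _ ⟨n, rfl⟩
    by_cases h : k < n
    · simpa [h] using Or.inl (hC n h)
    · simp [h]⟩

/-- The canonical map `φ_k : A k → ∏ Aₙ / ⨁ Aₙ`. -/
noncomputable def toCorona (k : ℕ) (x : A k) : Corona A := Corona.mk (S.toProd k x)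

/-- The generalized inductive limit: the closure of the union of the images `φ_k(A k)` in
`∏ Aₙ / ⨁ Aₙ` (a C⋆-subalgebra). -/
def limit : Set (Corona A) := closure (⋃ k, Set.range (S.toCorona k))

end GeneralizedInductiveSystem

/-- An MF-algebra: a separable C⋆-algebra that is ⋆-isomorphic to the limit of a generalized
inductive system of finite-dimensional C⋆-algebras. -/
def IsMF (A : Type*) [NonUnitalCStarAlgebra A] : Prop :=
  TopologicalSpace.SeparableSpace A ∧
    ∃ (F : ℕ → Type) (_ : ∀ n, NonUnitalCStarAlgebra (F n)) (_ : ∀ n, FiniteDimensional ℂ (F n))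
      (S : GeneralizedInductiveSystem F) (f : A →⋆ₙₐ[ℂ] Corona F),
      Function.Injective f ∧ Set.range f = S.limit

open scoped ComplexOrder

/-! ### Approximate homomorphisms -/

/-! The proof has two halves. First, a separable algebra is MF as soon as every finite set has
approximately isometric, approximately multiplicative maps into finite-dimensional algebras. Take
such maps `ψ n` on increasing finite sets `G n` with dense union, each injective on `G n`, and
connect `F m` to `F n` by choosing a preimage in `G m` and applying `ψ n`. Injectivity makes these
maps coherent exactly; approximate isometry makes them asymptotically algebraic
(`norm_ψ_lift_sub_lt`). The sequence `ψ n` itself gives an isometric ⋆-homomorphism of `A` into the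
corona, whose range is the limit.

Second, TAI supplies the maps: compress to an interval subalgebra `I` by a nearly central
projection, choose nearby points of `I`, and evaluate functions at a point of the interval. One
compression controls the norm of one element only, so it nearly preserves one prescribed distance.
The direct sum over all pairs of points of the finite set preserves every distance. -/

/-- A map which, on the set `G` and up to `ε`, is additive, homogeneous, ⋆-preserving,
multiplicative and contractive. -/
structure IsApproxContraction {A B : Type*} [NonUnitalCStarAlgebra A] [NonUnitalCStarAlgebra B]
    (ψ : A → B) (G : Set A) (ε : ℝ) : Prop where
  -- The set `G` is not closed under the operations, so the result `b + c` is replaced by a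
  -- competitor `g ∈ G`, at the cost of its distance to `b + c`; likewise below.
  add : ∀ g ∈ G, ∀ b ∈ G, ∀ c ∈ G, ‖ψ g - (ψ b + ψ c)‖ ≤ ‖g - (b + c)‖ + ε
  smul : ∀ g ∈ G, ∀ b ∈ G, ∀ r : ℂ, ‖ψ g - r • ψ b‖ ≤ ‖g - r • b‖ + (1 + ‖r‖) * ε
  star : ∀ g ∈ G, ∀ b ∈ G, ‖ψ g - star (ψ b)‖ ≤ ‖g - star b‖ + ε
  mul : ∀ g ∈ G, ∀ b ∈ G, ∀ c ∈ G, ‖ψ g - ψ b * ψ c‖ ≤ ‖g - b * c‖ + ε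

/-- An approximate contraction which, on the set `G` and up to `ε`, is isometric. -/
structure IsApproxHom {A B : Type*} [NonUnitalCStarAlgebra A] [NonUnitalCStarAlgebra B]
    (ψ : A → B) (G : Set A) (ε : ℝ) : Prop extends IsApproxContraction ψ G ε where
  sub_le : ∀ g ∈ G, ∀ b ∈ G, ‖g - b‖ ≤ ‖ψ g - ψ b‖ + ε

/-- Contractivity is homogeneity with scalar `0`. -/
theorem IsApproxContraction.norm_le {A B : Type*} [NonUnitalCStarAlgebra A]
    [NonUnitalCStarAlgebra B] {ψ : A → B} {G : Set A} {ε : ℝ} (h : IsApproxContraction ψ G ε)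
    {g : A} (hg : g ∈ G) : ‖ψ g‖ ≤ ‖g‖ + ε := by
  simpa using h.smul g hg g hg 0

theorem IsApproxContraction.pi {ι A : Type*} [Fintype ι] {B : ι → Type*}
    [NonUnitalCStarAlgebra A] [∀ i, NonUnitalCStarAlgebra (B i)] {ψ : ∀ i, A → B i} {G : Set A}
    {ε : ℝ} (hε : 0 ≤ ε) (h : ∀ i, IsApproxContraction (ψ i) G ε) :
    IsApproxContraction (fun a i => ψ i a) G ε where
  add g hg b hb c hc :=
    (pi_norm_le_iff_of_nonneg (by positivity)).mpr fun i => (h i).add g hg b hb c hc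
  smul g hg b hb r :=
    (pi_norm_le_iff_of_nonneg (by positivity)).mpr fun i => (h i).smul g hg b hb r
  star g hg b hb :=
    (pi_norm_le_iff_of_nonneg (by positivity)).mpr fun i => (h i).star g hg b hb
  mul g hg b hb c hc :=
    (pi_norm_le_iff_of_nonneg (by positivity)).mpr fun i => (h i).mul g hg b hb c hc

/-- A sequence of approximate homomorphisms, each injective on its finite set, defined on an
increasing sequence of finite sets with dense union. -/
structure ApproxHomSequence (A : Type*) [NonUnitalCStarAlgebra A] (F : ℕ → Type*)
    [∀ n, NonUnitalCStarAlgebra (F n)] where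
  /-- The finite sets. -/
  G : ℕ → Finset A
  /-- The approximate homomorphisms. -/
  ψ : ∀ n, A → F n
  /-- The errors. -/
  ε : ℕ → ℝ
  nonempty : ∀ n, (G n).Nonempty
  mono : Monotone G
  dense : ∀ a : A, ∀ η : ℝ, 0 < η → ∃ n, ∃ g ∈ G n, ‖g - a‖ < η
  approx : ∀ n, IsApproxHom (ψ n) (G n) (ε n)
  injOn : ∀ n, Set.InjOn (ψ n) (G n)
  ε_le_one : ∀ n, ε n ≤ 1
  tendsto_ε : Filter.Tendsto ε Filter.atTop (nhds 0)

/-! ### The corona norm as an upper limit -/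

namespace Corona

variable {F : ℕ → Type*} [∀ n, NonUnitalCStarAlgebra (F n)]

theorem mk_eq_mk_iff {x y : lp F ∞} :
    mk x = mk y ↔ Filter.Tendsto (fun n => ‖x n - y n‖) Filter.atTop (nhds 0) :=
  Submodule.Quotient.eq (c0Sum F)

/-- Representatives of one class differ by a null sequence, so entries that are large infinitely
often remain so in a representative of nearly minimal norm. -/
theorem le_norm_mk {x : lp F ∞} {l : ℝ} (h : ∀ η > 0, ∃ᶠ n in Filter.atTop, l - η < ‖x n‖) :
    l ≤ ‖mk x‖ := by
  refine le_of_forall_pos_lt_add fun η hη => ?_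
  obtain ⟨z, hz, hlt⟩ := Submodule.Quotient.norm_mk_lt (S := c0Sum F) (mk x)
    (show 0 < η / 3 by positivity)
  replace hlt : ‖z‖ < ‖mk x‖ + η / 3 := hlt
  have hz' : mk z = mk x := hz
  have h0 := Metric.tendsto_atTop.mp (mk_eq_mk_iff.mp hz') (η / 3) (by positivity)
  obtain ⟨N, hN⟩ := h0
  obtain ⟨n, hn, hn'⟩ := ((h (η / 3) (by positivity)).and_eventually
    (Filter.eventually_ge_atTop N)).exists
  have h1 := hN n hn'
  rw [Real.dist_eq, sub_zero, abs_of_nonneg (norm_nonneg _)] at h1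
  have h2 := norm_sub_norm_le (x n) (z n)
  rw [norm_sub_rev] at h2
  have h3 := lp.norm_apply_le_norm (by simp) z n
  linarith

/-- Replacing finitely many entries by zero does not change the class. -/
theorem norm_mk_le {x : lp F ∞} {l : ℝ} (hl : 0 ≤ l)
    (h : ∀ η > 0, ∀ᶠ n in Filter.atTop, ‖x n‖ ≤ l + η) : ‖mk x‖ ≤ l := by
  refine le_of_forall_pos_le_add fun η hη => ?_
  obtain ⟨N, hN⟩ := Filter.eventually_atTop.mp (h η hη)
  have hmem : Memℓp (fun n => if N ≤ n then x n else 0) ∞ := by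
    refine memℓp_infty ⟨l + η, ?_⟩
    rintro _ ⟨n, rfl⟩
    by_cases hn : N ≤ n
    · simpa [hn] using hN n hn
    · simp [hn]; positivity
  let z : lp F ∞ := ⟨_, hmem⟩
  have hz : mk x = mk z := by
    rw [mk_eq_mk_iff]
    refine tendsto_const_nhds.congr' ?_
    filter_upwards [Filter.eventually_ge_atTop N] with n hn
    simp [z, hn]
  rw [hz]
  refine (Submodule.Quotient.norm_mk_le (c0Sum F) z).trans ?_
  refine lp.norm_le_of_forall_le (by positivity) fun n => ?_
  by_cases hn : N ≤ n
  · simpa [z, hn] using hN n hn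
  · simp [z, hn]; positivity

theorem norm_mk_of_tendsto {x : lp F ∞} {l : ℝ}
    (h : Filter.Tendsto (fun n => ‖x n‖) Filter.atTop (nhds l)) : ‖mk x‖ = l := by
  have hl : 0 ≤ l := ge_of_tendsto' h fun n => norm_nonneg _
  refine le_antisymm (norm_mk_le hl fun η hη => ?_) (le_norm_mk fun η hη => ?_)
  · exact (h.eventually (gt_mem_nhds (by linarith : l < l + η))).mono fun n hn => hn.le
  · exact (h.eventually (lt_mem_nhds (by linarith : l - η < l))).frequently

/-- The quotient seminorm is a norm: a sequence that is not null stays above some `l > 0` infinitely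
often. -/
theorem eq_zero_of_norm_eq_zero {x : Corona F} (hx : ‖x‖ = 0) : x = 0 := by
  obtain ⟨x, rfl⟩ := mk_surjective x
  rw [← map_zero mk, mk_eq_mk_iff]
  by_contra hcon
  rw [Metric.tendsto_atTop] at hcon
  push Not at hcon
  obtain ⟨l, hl, hcon⟩ := hcon
  have : l ≤ ‖mk x‖ := le_norm_mk fun η hη => Filter.frequently_atTop.mpr fun N => by
    obtain ⟨n, hn, hn'⟩ := hcon N
    refine ⟨n, hn, ?_⟩
    simp at hn'
    linarith
  linarith

end Corona

/-! ### The inductive system of a sequence of approximate homomorphisms, and its limit -/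

namespace ApproxHomSequence

variable {A : Type*} [NonUnitalCStarAlgebra A] {F : ℕ → Type*}
  [∀ n, NonUnitalCStarAlgebra (F n)] (S : ApproxHomSequence A F)

theorem exists_nearest (n : ℕ) (a : A) :
    ∃ g ∈ S.G n, ∀ g' ∈ S.G n, ‖g - a‖ ≤ ‖g' - a‖ :=
  (S.G n).exists_min_image (fun g => ‖g - a‖) (S.nonempty n)

theorem exists_lift (n : ℕ) (z : F n) :
    ∃ g ∈ S.G n, ∀ g' ∈ S.G n, ‖S.ψ n g - z‖ ≤ ‖S.ψ n g' - z‖ :=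
  (S.G n).exists_min_image (fun g => ‖S.ψ n g - z‖) (S.nonempty n)

/-- A point of `G n` nearest to `a`. -/
noncomputable def nearest (n : ℕ) (a : A) : A := (S.exists_nearest n a).choose

/-- A point of `G n` whose image under `ψ n` is as near as possible to `z`. -/
noncomputable def lift (n : ℕ) (z : F n) : A := (S.exists_lift n z).choose

theorem nearest_mem (n : ℕ) (a : A) : S.nearest n a ∈ S.G n := (S.exists_nearest n a).choose_spec.1

theorem norm_nearest_sub_le (n : ℕ) (a : A) {g : A} (hg : g ∈ S.G n) :
    ‖S.nearest n a - a‖ ≤ ‖g - a‖ := (S.exists_nearest n a).choose_spec.2 g hg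

theorem lift_mem (n : ℕ) (z : F n) : S.lift n z ∈ S.G n := (S.exists_lift n z).choose_spec.1

theorem norm_lift_sub_le (n : ℕ) (z : F n) {g : A} (hg : g ∈ S.G n) :
    ‖S.ψ n (S.lift n z) - z‖ ≤ ‖S.ψ n g - z‖ := (S.exists_lift n z).choose_spec.2 g hg

theorem nearest_of_mem {n : ℕ} {g : A} (hg : g ∈ S.G n) : S.nearest n g = g := by
  simpa [sub_eq_zero] using S.norm_nearest_sub_le n g hg

theorem lift_ψ {n : ℕ} {g : A} (hg : g ∈ S.G n) : S.lift n (S.ψ n g) = g := by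
  refine S.injOn n (S.lift_mem n _) hg ?_
  simpa [sub_eq_zero] using S.norm_lift_sub_le n (S.ψ n g) hg

theorem tendsto_nearest (a : A) :
    Filter.Tendsto (fun n => S.nearest n a) Filter.atTop (nhds a) := by
  refine Metric.tendsto_atTop.mpr fun η hη => ?_
  obtain ⟨N, g, hg, hlt⟩ := S.dense a η hη
  refine ⟨N, fun n hn => ?_⟩
  rw [dist_eq_norm]
  exact (S.norm_nearest_sub_le n a (S.mono hn hg)).trans_lt hlt

/-- If the elements `z n` represent `u` from stage `k` on, then they are asymptotically preserved
by the maps `ψ n ∘ lift m`. -/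
theorem norm_ψ_lift_sub_lt {k : ℕ} {K : ℝ} (u : A) (z : ∀ n, F n)
    (hz : ∀ n, k < n → ∀ g ∈ S.G n, ‖S.ψ n g - z n‖ ≤ ‖g - u‖ + K * S.ε n)
    {η : ℝ} (hη : 0 < η) :
    ∃ M : ℕ, ∀ m n : ℕ, k < m → m < n → M ≤ m → ‖S.ψ n (S.lift m (z m)) - z n‖ < η := by
  have h1 : ∀ᶠ n in Filter.atTop, S.ε n < η / 10 :=
    S.tendsto_ε.eventually (gt_mem_nhds (by positivity))
  have h2 : ∀ᶠ n in Filter.atTop, K * S.ε n < η / 10 := by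
    have := S.tendsto_ε.const_mul K
    rw [mul_zero] at this
    exact this.eventually (gt_mem_nhds (by positivity))
  have h3 : ∀ᶠ n in Filter.atTop, ‖S.nearest n u - u‖ < η / 10 := by
    have := (S.tendsto_nearest u).sub_const u |>.norm
    rw [sub_self, norm_zero] at this
    exact this.eventually (gt_mem_nhds (by positivity))
  obtain ⟨M, hM⟩ := Filter.eventually_atTop.mp (h1.and (h2.and h3))
  refine ⟨M, fun m n hkm hmn hm => ?_⟩
  obtain ⟨hm1, hm2, hm3⟩ := hM m hm
  obtain ⟨-, hn2, -⟩ := hM n (hm.trans hmn.le)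
  -- The point of `G m` nearest to `u` competes in the definition of `lift m (z m)`, so both have
  -- images near `z m`. By approximate isometry they are close in `A`, which places the lift within
  -- `6η/10` of `u`; then `hz` applies at stage `n`.
  have hl := S.lift_mem m (z m)
  have hg := S.nearest_mem m u
  have e1 := hz m hkm _ hg
  have e2 := S.norm_lift_sub_le m (z m) hg
  have e3 := (S.approx m).sub_le _ hl _ hg
  have e4 := norm_sub_le_norm_sub_add_norm_sub (S.ψ m (S.lift m (z m))) (z m)
    (S.ψ m (S.nearest m u))
  rw [norm_sub_rev (z m)] at e4
  have e5 := norm_sub_le_norm_sub_add_norm_sub (S.lift m (z m)) (S.nearest m u) u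
  have e6 := hz n (hkm.trans hmn) _ (S.mono hmn.le hl)
  linarith

/-- The generalized inductive system with connecting maps `ψ n ∘ lift m`. -/
noncomputable def system : GeneralizedInductiveSystem F where
  map {m n} _ x := S.ψ n (S.lift m x)
  -- The lift of `x` lies in `G k ⊆ G m`, where `lift m` inverts `ψ m` exactly.
  coherent {k m n} hkm hmn x := by
    rw [S.lift_ψ (S.mono hkm.le (S.lift_mem k x))]
  asymp_add k x y η hη := by
    refine S.norm_ψ_lift_sub_lt (k := k) (K := 1) (S.lift k x + S.lift k y)
      (fun n => S.ψ n (S.lift k x) + S.ψ n (S.lift k y)) (fun n hn g hg => ?_) hη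
    rw [one_mul]
    exact (S.approx n).add g hg _ (S.mono hn.le (S.lift_mem k x)) _
      (S.mono hn.le (S.lift_mem k y))
  asymp_smul k c x η hη := by
    refine S.norm_ψ_lift_sub_lt (k := k) (K := 1 + ‖c‖) (c • S.lift k x)
      (fun n => c • S.ψ n (S.lift k x)) (fun n hn g hg => ?_) hη
    exact (S.approx n).smul g hg _ (S.mono hn.le (S.lift_mem k x)) c
  asymp_star k x η hη := by
    refine S.norm_ψ_lift_sub_lt (k := k) (K := 1) (star (S.lift k x))
      (fun n => star (S.ψ n (S.lift k x))) (fun n hn g hg => ?_) hη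
    rw [one_mul]
    exact (S.approx n).star g hg _ (S.mono hn.le (S.lift_mem k x))
  asymp_mul k x y η hη := by
    refine S.norm_ψ_lift_sub_lt (k := k) (K := 1) (S.lift k x * S.lift k y)
      (fun n => S.ψ n (S.lift k x) * S.ψ n (S.lift k y)) (fun n hn g hg => ?_) hη
    rw [one_mul]
    exact (S.approx n).mul g hg _ (S.mono hn.le (S.lift_mem k x)) _
      (S.mono hn.le (S.lift_mem k y))
  bounded k x := ⟨‖S.lift k x‖ + 1, fun r hkr =>
    ((S.approx r).norm_le (S.mono hkr.le (S.lift_mem k x))).trans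
      (by linarith [S.ε_le_one r])⟩

theorem memℓp_ψ_nearest (a : A) : Memℓp (fun n => S.ψ n (S.nearest n a)) ∞ := by
  obtain ⟨C, hC⟩ := (S.tendsto_nearest a).norm.bddAbove_range
  refine memℓp_infty ⟨C + 1, ?_⟩
  rintro _ ⟨n, rfl⟩
  have h1 := (S.approx n).norm_le (S.nearest_mem n a)
  have h2 := S.ε_le_one n
  have h3 := hC ⟨n, rfl⟩
  simp only at h3 ⊢
  linarith

/-- The bounded sequence of images of the points nearest to `a`. -/
noncomputable def toProd (a : A) : lp F ∞ := ⟨_, S.memℓp_ψ_nearest a⟩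

theorem toProd_apply (a : A) (n : ℕ) : S.toProd a n = S.ψ n (S.nearest n a) := rfl

/-- The common source of the algebraic identities for `toCorona`: `u n` is the operation applied to
nearest points, `x n` the operation applied to their images, and both errors vanish in the limit. -/
theorem mk_toProd_eq {K : ℝ} (a : A) (x : lp F ∞) (u : ℕ → A)
    (hu : Filter.Tendsto u Filter.atTop (nhds a))
    (h : ∀ n, ‖S.ψ n (S.nearest n a) - x n‖ ≤ ‖S.nearest n a - u n‖ + K * S.ε n) :
    Corona.mk (S.toProd a) = Corona.mk x := by
  rw [Corona.mk_eq_mk_iff]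
  refine squeeze_zero (fun n => norm_nonneg _) h ?_
  simpa using ((S.tendsto_nearest a).sub hu).norm.add (S.tendsto_ε.const_mul K)

/-- The ⋆-homomorphism into `∏ Fₙ / ⨁ Fₙ` defined by a sequence of approximate homomorphisms. -/
noncomputable def toCorona : A →⋆ₙₐ[ℂ] Corona F where
  toFun a := Corona.mk (S.toProd a)
  map_smul' c a := by
    change _ = c • Corona.mk (S.toProd a)
    rw [← map_smul]
    exact S.mk_toProd_eq (K := 1 + ‖c‖) _ _ _ ((S.tendsto_nearest a).const_smul c) fun n =>
      (S.approx n).smul _ (S.nearest_mem n _) _ (S.nearest_mem n a) c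
  map_zero' := by
    rw [← map_zero Corona.mk]
    refine S.mk_toProd_eq (K := 1) _ _ _ tendsto_const_nhds fun n => ?_
    simpa using (S.approx n).norm_le (S.nearest_mem n 0)
  map_add' a b := by
    rw [← map_add]
    refine S.mk_toProd_eq (K := 1) _ _ _
      ((S.tendsto_nearest a).add (S.tendsto_nearest b)) fun n => ?_
    rw [one_mul]
    exact (S.approx n).add _ (S.nearest_mem n _) _ (S.nearest_mem n a) _ (S.nearest_mem n b)
  map_mul' a b := by
    rw [← Corona.mk_mul]
    refine S.mk_toProd_eq (K := 1) _ _ _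
      ((S.tendsto_nearest a).mul (S.tendsto_nearest b)) fun n => ?_
    rw [one_mul]
    exact (S.approx n).mul _ (S.nearest_mem n _) _ (S.nearest_mem n a) _ (S.nearest_mem n b)
  map_star' a := by
    rw [← Corona.mk_star]
    refine S.mk_toProd_eq (K := 1) _ _ _ (S.tendsto_nearest a).star fun n => ?_
    rw [one_mul]
    exact (S.approx n).star _ (S.nearest_mem n _) _ (S.nearest_mem n a)

theorem toCorona_apply (a : A) : S.toCorona a = Corona.mk (S.toProd a) := rfl

theorem norm_toCorona (a : A) : ‖S.toCorona a‖ = ‖a‖ := by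
  -- Approximate isometry compares only points of `G n`, which need not contain `0`; the point
  -- nearest to `0` stands in for it.
  have h0 : Filter.Tendsto (fun n => ‖S.ψ n (S.nearest n 0)‖) Filter.atTop (nhds 0) := by
    simpa [toProd_apply] using Corona.mk_eq_mk_iff.mp ((S.toCorona_apply 0).symm.trans
      ((map_zero S.toCorona).trans (map_zero Corona.mk).symm))
  rw [toCorona_apply]
  refine Corona.norm_mk_of_tendsto ?_
  have hup : Filter.Tendsto (fun n => ‖S.nearest n a‖ + S.ε n) Filter.atTop (nhds ‖a‖) := by
    simpa using (S.tendsto_nearest a).norm.add S.tendsto_ε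
  have hlo : Filter.Tendsto (fun n => ‖S.nearest n a - S.nearest n 0‖ - S.ε n
      - ‖S.ψ n (S.nearest n 0)‖) Filter.atTop (nhds ‖a‖) := by
    simpa using
      ((((S.tendsto_nearest a).sub (S.tendsto_nearest 0)).norm.sub S.tendsto_ε).sub h0)
  refine tendsto_of_tendsto_of_tendsto_of_le_of_le hlo hup (fun n => ?_) fun n =>
    (S.approx n).norm_le (S.nearest_mem n a)
  have h1 := (S.approx n).sub_le _ (S.nearest_mem n a) _ (S.nearest_mem n 0)
  have h2 := norm_sub_le (S.ψ n (S.nearest n a)) (S.ψ n (S.nearest n 0))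
  simp only [toProd_apply]
  linarith

theorem isometry_toCorona : Isometry S.toCorona :=
  AddMonoidHomClass.isometry_of_norm S.toCorona S.norm_toCorona

/-- An isometric image of a complete space; since the corona carries only a seminormed instance,
uniqueness of limits goes through `eq_zero_of_norm_eq_zero`. -/
theorem isClosed_range_toCorona : IsClosed (Set.range S.toCorona) := by
  refine isClosed_of_closure_subset fun y hy => ?_
  obtain ⟨x, hx, hxy⟩ := mem_closure_iff_seq_limit.mp hy
  choose a ha using hx
  have hc : CauchySeq a := by
    refine S.isometry_toCorona.isUniformInducing.cauchy_map_iff.mp ?_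
    rw [Filter.map_map]
    rw [show S.toCorona ∘ a = x from funext ha]
    exact hxy.cauchySeq
  obtain ⟨l, hl⟩ := cauchySeq_tendsto_of_complete hc
  have hfl : Filter.Tendsto x Filter.atTop (nhds (S.toCorona l)) := by
    convert (S.isometry_toCorona.continuous.tendsto l).comp hl using 1
    exact (funext ha).symm
  have h0 := (hfl.sub hxy).norm
  simp only [sub_self, norm_zero] at h0
  exact ⟨l, sub_eq_zero.mp (Corona.eq_zero_of_norm_eq_zero 
    (tendsto_nhds_unique h0 tendsto_const_nhds))⟩

/-- Beyond stage `k` the lift belongs to `G n` and is its own nearest point, so the two sequences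
eventually agree. -/
theorem system_toCorona (k : ℕ) (x : F k) : S.system.toCorona k x = S.toCorona (S.lift k x) := by
  rw [toCorona_apply, GeneralizedInductiveSystem.toCorona, Corona.mk_eq_mk_iff]
  refine tendsto_const_nhds.congr' ?_
  filter_upwards [Filter.eventually_gt_atTop k] with n hn
  rw [toProd_apply, S.nearest_of_mem (S.mono hn.le (S.lift_mem k x))]
  simp [GeneralizedInductiveSystem.toProd, hn, system]

theorem range_toCorona : Set.range S.toCorona = S.system.limit := by
  refine Set.Subset.antisymm ?_ (closure_minimal ?_ S.isClosed_range_toCorona)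
  · rintro _ ⟨a, rfl⟩
    refine mem_closure_of_tendsto
      ((S.isometry_toCorona.continuous.tendsto a).comp (S.tendsto_nearest a))
      (Filter.Eventually.of_forall fun n => Set.mem_iUnion.mpr ⟨n, S.ψ n (S.nearest n a), ?_⟩)
    rw [system_toCorona, S.lift_ψ (S.nearest_mem n a)]
    rfl
  · refine Set.iUnion_subset fun k => ?_
    rintro _ ⟨x, rfl⟩
    exact ⟨_, (S.system_toCorona k x).symm⟩

end ApproxHomSequence

/-! ### The local criterion for MF-algebras -/

theorem isMF_of_approxHomSequence {A : Type*} [NonUnitalCStarAlgebra A]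
    [TopologicalSpace.SeparableSpace A] {F : ℕ → Type} [∀ n, NonUnitalCStarAlgebra (F n)]
    [∀ n, FiniteDimensional ℂ (F n)] (S : ApproxHomSequence A F) : IsMF A := by
  refine ⟨inferInstance, F, inferInstance, inferInstance, S.system, S.toCorona, fun a b hab => ?_,
    S.range_toCorona⟩
  have h := S.norm_toCorona (a - b)
  rw [map_sub, hab, sub_self, norm_zero] at h
  exact sub_eq_zero.mp (norm_eq_zero.mp h.symm)

/-- If every finite subset of a separable C⋆-algebra has approximate homomorphisms into
finite-dimensional C⋆-algebras, then the algebra is MF. -/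
theorem isMF_of_exists_isApproxHom {A : Type*} [NonUnitalCStarAlgebra A]
    [TopologicalSpace.SeparableSpace A]
    (h : ∀ (G : Finset A) (ε : ℝ), 0 < ε →
      ∃ (B : Type) (_ : NonUnitalCStarAlgebra B) (_ : FiniteDimensional ℂ B) (ψ : A → B),
        IsApproxHom ψ G ε) : IsMF A := by
  classical
  let G : ℕ → Finset A := fun n => (Finset.range (n + 1)).image (TopologicalSpace.denseSeq A)
  have hpos : ∀ n : ℕ, (0 : ℝ) < 1 / ((n : ℝ) + 1) := fun n => by positivity
  have key : ∀ n : ℕ, ∃ (B : Type) (_ : NonUnitalCStarAlgebra B) (_ : FiniteDimensional ℂ B)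
      (ψ : A → B) (ε : ℝ), IsApproxHom ψ (G n) ε ∧ Set.InjOn ψ (G n) ∧ 0 ≤ ε ∧
        ε ≤ 1 / ((n : ℝ) + 1) := by
    intro n
    -- Here `δ` separates the points of `G n`; an isometry error of at most `δ / 2` then forces
    -- injectivity on `G n`.
    obtain ⟨δ, hδ, hsep⟩ : ∃ δ > 0, ∀ x ∈ G n, ∀ y ∈ G n, x ≠ y → δ ≤ ‖x - y‖ := by
      rcases (G n).offDiag.eq_empty_or_nonempty with he | hne
      · refine ⟨1, one_pos, fun x hx y hy hxy => ?_⟩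
        have : (x, y) ∈ (G n).offDiag := Finset.mem_offDiag.mpr ⟨hx, hy, hxy⟩
        simp [he] at this
      · obtain ⟨q, hq, hmin⟩ := (G n).offDiag.exists_min_image (fun q => ‖q.1 - q.2‖) hne
        exact ⟨‖q.1 - q.2‖, norm_pos_iff.mpr (sub_ne_zero.mpr (Finset.mem_offDiag.mp hq).2.2),
          fun x hx y hy hxy => hmin (x, y) (Finset.mem_offDiag.mpr ⟨hx, hy, hxy⟩)⟩
    obtain ⟨B, i, j, ψ, hψ⟩ := h (G n) (min (1 / ((n : ℝ) + 1)) (δ / 2))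
      (lt_min (hpos n) (by positivity))
    refine ⟨B, i, j, ψ, _, hψ, fun x hx y hy hxy => ?_,
      (lt_min (hpos n) (by positivity)).le, min_le_left _ _⟩
    by_contra hne
    have h1 := hψ.sub_le x hx y hy
    rw [hxy, sub_self, norm_zero] at h1
    linarith [hsep x hx y hy hne, min_le_right (1 / ((n : ℝ) + 1)) (δ / 2)]
  choose B i j ψ ε hψ hinj hε0 hε using key
  refine isMF_of_approxHomSequence (F := B)
    { G := G
      ψ := ψ
      ε := ε
      nonempty := fun n => ⟨_, Finset.mem_image_of_mem _ (Finset.mem_range.mpr n.succ_pos)⟩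
      mono := fun m n hmn => Finset.image_subset_image (Finset.range_mono (by omega))
      dense := fun a η hη => ?_
      approx := hψ
      injOn := hinj
      ε_le_one := fun n => (hε n).trans ?_
      tendsto_ε := squeeze_zero hε0 hε tendsto_one_div_add_atTop_nhds_zero_nat }
  · obtain ⟨n, hn⟩ := (TopologicalSpace.denseRange_denseSeq A).exists_dist_lt a hη
    rw [dist_eq_norm, norm_sub_rev] at hn
    exact ⟨n, _, Finset.mem_image_of_mem _ (Finset.mem_range.mpr n.lt_succ_self), hn⟩
  · rw [div_le_one (by positivity)]
    simp

/-! ### Approximate homomorphisms of TAI algebras -/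

section Evaluation

variable {m n : ℕ} {k : Fin m → ℕ} {l : Fin n → ℕ}

/-- The fibres of the algebra `IntervalModel k l`. -/
abbrev IntervalModelFibre {m n : ℕ} (k : Fin m → ℕ) (l : Fin n → ℕ) : Type :=
  ((i : Fin m) → CStarMatrix (Fin (k i)) (Fin (k i)) ℂ) ×
    ((j : Fin n) → CStarMatrix (Fin (l j)) (Fin (l j)) ℂ)

instance : FiniteDimensional ℂ (IntervalModelFibre k l) :=
  inferInstanceAs (FiniteDimensional ℂ (((i : Fin m) → Matrix (Fin (k i)) (Fin (k i)) ℂ) ×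
    ((j : Fin n) → Matrix (Fin (l j)) (Fin (l j)) ℂ)))

/-- Evaluation of the functions in `IntervalModel k l` at the point `t`. -/
noncomputable def IntervalModel.eval (t : unitInterval) :
    IntervalModel k l →⋆ₙₐ[ℂ] IntervalModelFibre k l where
  toFun x := (fun i => CStarMatrix.ofMatrix (x.1 i),
    fun j => CStarMatrix.ofMatrix ((x.2 j).map fun f => f t))
  map_smul' c x := by ext <;> rfl
  map_zero' := by ext <;> rfl
  map_add' x y := by ext <;> rfl
  map_mul' x y := by
    refine Prod.ext rfl (funext fun j => ?_)
    ext a b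
    simp [CStarMatrix.mul_apply, Matrix.mul_apply]
  map_star' x := by ext <;> rfl

theorem IntervalModel.eval_injective {x y : IntervalModel k l}
    (h : ∀ t, IntervalModel.eval t x = IntervalModel.eval t y) : x = y := by
  -- The constant matrix summands do not depend on `t`, so evaluation at `0` already detects them.
  refine Prod.ext (congrArg (fun z : IntervalModelFibre k l => z.1) (h 0)) (funext fun j => ?_)
  ext a b t
  exact congrArg (fun z : IntervalModelFibre k l => z.2 j a b) (h t)

end Evaluation

/-- Point evaluations norm an algebra in the class of interval algebras. -/
theorem exists_norm_sub_lt_norm_eval {B : Type*} [NonUnitalCStarAlgebra B] {m n : ℕ}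
    {k : Fin m → ℕ} {l : Fin n → ℕ} (e : B ≃⋆ₐ[ℂ] IntervalModel k l) (y : B) {ε : ℝ}
    (hε : 0 < ε) :
    ∃ π : B →⋆ₙₐ[ℂ] IntervalModelFibre k l, ‖y‖ - ε < ‖π y‖ := by
  let π : unitInterval → B →⋆ₙₐ[ℂ] IntervalModelFibre k l := fun t =>
    (IntervalModel.eval t).comp (e : B →⋆ₙₐ[ℂ] IntervalModel k l)
  have hmem : ∀ x : B, Memℓp (fun t => π t x) ∞ := fun x => memℓp_infty ⟨‖x‖, by
    rintro _ ⟨t, rfl⟩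
    exact NonUnitalStarAlgHom.norm_apply_le (π t) x⟩
  -- All point evaluations together form an injective ⋆-homomorphism of C⋆-algebras, hence an
  -- isometric one, although `e` is only an algebraic isomorphism. A uniform bound `‖y‖ - ε` on the
  -- evaluations is therefore impossible.
  let Φ : B →⋆ₙₐ[ℂ] lp (fun _ : unitInterval => IntervalModelFibre k l) ∞ :=
    { toFun := fun x => ⟨fun t => π t x, hmem x⟩
      map_smul' := fun c x => by ext1; funext t; exact map_smul (π t) c x
      map_zero' := by ext1; funext t; exact map_zero (π t)
      map_add' := fun x y => by ext1; funext t; exact map_add (π t) x y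
      map_mul' := fun x y => by ext1; funext t; exact map_mul (π t) x y
      map_star' := fun x => by ext1; funext t; exact map_star (π t) x }
  have hinj : Function.Injective Φ := fun x x' h => e.injective
    (IntervalModel.eval_injective fun t => congrFun (congrArg Subtype.val h) t)
  by_contra! hcon
  have h1 := NonUnitalStarAlgHom.norm_map Φ hinj y
  have h2 : ‖Φ y‖ ≤ max (‖y‖ - ε) 0 := lp.norm_le_of_forall_le (le_max_right _ _) fun t =>
    (hcon (π t)).trans (le_max_left _ _)
  have h3 := (norm_nonneg _).trans (hcon (π 0))
  rw [max_eq_left h3] at h2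
  linarith

/-! ### Compression by the TAI projections -/

theorem isFullElement_one {A : Type*} [CStarAlgebra A] : IsFullElement (1 : A) := by
  have h : (TwoSidedIdeal.span {(1 : A)} : Set A) = Set.univ := Set.eq_univ_of_forall fun x => by
    have h1 : (1 : A) ∈ TwoSidedIdeal.span {(1 : A)} := TwoSidedIdeal.subset_span rfl
    simpa using (TwoSidedIdeal.span {(1 : A)}).mul_mem_left x 1 h1
  rw [IsFullElement, h, closure_univ]

theorem IsStarProjection.norm_mul_mul_self_le {A : Type*} [NonUnitalCStarAlgebra A] {p : A}
    (hp : IsStarProjection p) (x : A) : ‖p * x * p‖ ≤ ‖x‖ := by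
  have hp1 : ‖p‖ ≤ 1 := IsStarProjection.norm_le p hp
  calc ‖p * x * p‖ ≤ ‖p‖ * ‖x‖ * ‖p‖ := norm_mul₃_le
    _ ≤ 1 * ‖x‖ * 1 := by gcongr
    _ = ‖x‖ := by ring

/-- Compression by a nearly central projection, followed by the choice of nearby points, is
nearly multiplicative. -/
theorem norm_sub_mul_le_of_compress {A : Type*} [CStarAlgebra A] {p b c g y z w : A} {C δ : ℝ}
    (hp : IsStarProjection p) (hb : ‖b‖ ≤ C) (hc : ‖c‖ ≤ C) (hδ : δ ≤ 1)
    (hcp : ‖c * p - p * c‖ ≤ δ) (hy : ‖p * b * p - y‖ ≤ δ) (hz : ‖p * c * p - z‖ ≤ δ)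
    (hw : ‖p * g * p - w‖ ≤ δ) : ‖w - y * z‖ ≤ ‖g - b * c‖ + (3 * C + 2) * δ := by
  have hp1 : ‖p‖ ≤ 1 := IsStarProjection.norm_le p hp
  have hcompress := hp.norm_mul_mul_self_le
  have hC : 0 ≤ C := (norm_nonneg b).trans hb
  have hδ0 : 0 ≤ δ := (norm_nonneg _).trans hy
  have hpp : p * p = p := hp.isIdempotentElem
  have hyn : ‖y‖ ≤ C + δ := by
    have := norm_sub_norm_le y (p * b * p)
    rw [norm_sub_rev] at this
    linarith [hcompress b]
  -- The terms are, in order: the choice of `w`, the defect `g - b * c`, the commutator of `c` with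
  -- `p`, and the choices of `y` and `z`. With `δ ^ 2 ≤ δ` they add up to `(3 * C + 2) * δ` beyond
  -- the defect.
  have e : w - y * z = -(p * g * p - w) + p * (g - b * c) * p
      + p * b * (c * p - p * c) * p + (p * b * p - y) * (p * c * p) + y * (p * c * p - z) := by
    have h1 : p * b * (c * p - p * c) * p = p * (b * c) * p - (p * b * p) * (p * c * p) := by
      calc p * b * (c * p - p * c) * p = p * (b * c) * (p * p) - p * b * p * c * p := by noncomm_ring
        _ = p * (b * c) * p - p * b * (p * p) * c * p := by rw [hpp]
        _ = _ := by noncomm_ring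
    rw [h1]
    noncomm_ring
  have n2 : ‖p * b * (c * p - p * c) * p‖ ≤ C * δ :=
    calc ‖p * b * (c * p - p * c) * p‖ ≤ ‖p * b‖ * ‖c * p - p * c‖ * ‖p‖ := norm_mul₃_le
      _ ≤ (‖p‖ * ‖b‖) * ‖c * p - p * c‖ * ‖p‖ := by gcongr; exact norm_mul_le _ _
      _ ≤ (1 * C) * δ * 1 := by gcongr
      _ = C * δ := by ring
  have n3 : ‖(p * b * p - y) * (p * c * p)‖ ≤ δ * C :=
    (norm_mul_le _ _).trans (mul_le_mul hy ((hcompress c).trans hc) (norm_nonneg _) hδ0)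
  have n4 : ‖y * (p * c * p - z)‖ ≤ (C + δ) * δ :=
    (norm_mul_le _ _).trans (mul_le_mul hyn hz (norm_nonneg _) (by positivity))
  have n5 : δ * δ ≤ 1 * δ := by gcongr
  rw [e]
  refine (norm_add_le _ _).trans ?_
  have t1 := norm_add_le (-(p * g * p - w) + p * (g - b * c) * p
      + p * b * (c * p - p * c) * p) ((p * b * p - y) * (p * c * p))
  have t2 := norm_add_le (-(p * g * p - w) + p * (g - b * c) * p) (p * b * (c * p - p * c) * p)
  have t3 := norm_add_le (-(p * g * p - w)) (p * (g - b * c) * p)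
  rw [norm_neg] at t3
  linarith [hcompress (g - b * c)]

/-- A TAI algebra has finite-dimensional approximate contractions which nearly preserve the
distance of a given pair of points. -/
theorem IsTAI.exists_isApproxContraction {A : Type*} [CStarAlgebra A] [PartialOrder A]
    [StarOrderedRing A] (hA : IsTAI A) (G : Finset A) {g₀ b₀ : A} (hg₀ : g₀ ∈ G) (hb₀ : b₀ ∈ G)
    (hne : g₀ ≠ b₀) {ε : ℝ} (hε : 0 < ε) :
    ∃ (B : Type) (_ : NonUnitalCStarAlgebra B) (_ : FiniteDimensional ℂ B) (ψ : A → B),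
      IsApproxContraction ψ G ε ∧ ‖g₀ - b₀‖ ≤ ‖ψ g₀ - ψ b₀‖ + ε := by
  classical
  obtain ⟨C, hC0, hC⟩ : ∃ C : ℝ, 0 ≤ C ∧ ∀ g ∈ G, ‖g‖ ≤ C :=
    ⟨∑ g ∈ G, ‖g‖, by positivity, fun g hg =>
      Finset.single_le_sum (f := fun g => ‖g‖) (fun _ _ => norm_nonneg _) hg⟩
  -- Products cost `(3 * C + 2) * δ`; the lower bound on the distance costs `4 * δ`: one from TAI,
  -- two from the choices in `I`, one from evaluation.
  obtain ⟨δ, hδ, hδ1, hδε⟩ : ∃ δ : ℝ, 0 < δ ∧ δ ≤ 1 ∧ (3 * C + 4) * δ ≤ ε := by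
    refine ⟨min 1 (ε / (3 * C + 4)), by positivity, min_le_left _ _, ?_⟩
    calc (3 * C + 4) * min 1 (ε / (3 * C + 4)) ≤ (3 * C + 4) * (ε / (3 * C + 4)) := by
          gcongr; exact min_le_right _ _
      _ = ε := by field_simp
  have hCδ : 0 ≤ C * δ := by positivity
  -- The norm condition of TAI is spent on the difference `g₀ - b₀`. The comparison conditions are
  -- not needed, so `n = 1` and the full element `1` suffice.
  obtain ⟨p, I, hp, -, ⟨hIc, m, n, k, l, -, -, ⟨e⟩⟩, -, hcomm, hnear, hlow, -, -⟩ :=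
    hA (insert (g₀ - b₀) G) (g₀ - b₀) (Finset.mem_insert_self _ _) (sub_ne_zero.mpr hne) δ hδ 1
      one_pos 1 zero_le_one isFullElement_one
  have hex : ∀ x : A, ∃ y : I, x ∈ G → ‖p * x * p - y‖ ≤ δ := fun x => by
    by_cases hx : x ∈ G
    · obtain ⟨y, hy, hxy⟩ := hnear x (Finset.mem_insert_of_mem hx)
      exact ⟨⟨y, hy⟩, fun _ => hxy.le⟩
    · exact ⟨0, fun h => absurd h hx⟩
  choose y hy using hex
  have hcompress := hp.norm_mul_mul_self_le
  let _ : NonUnitalCStarAlgebra I :=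
    NonUnitalStarSubalgebra.nonUnitalCStarAlgebra I (h_closed := hIc)
  obtain ⟨π, hπ⟩ := exists_norm_sub_lt_norm_eval e (y g₀ - y b₀) hδ
  have hπle : ∀ z : I, ‖π z‖ ≤ ‖(z : A)‖ := NonUnitalStarAlgHom.norm_apply_le π
  refine ⟨IntervalModelFibre k l, inferInstance, inferInstance, fun x => π (y x),
    ⟨fun g hg b hb c hc => ?_, fun g hg b hb r => ?_, fun g hg b hb => ?_,
      fun g hg b hb c hc => ?_⟩, ?_⟩
  · rw [← map_add, ← map_sub]
    refine (hπle _).trans ?_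
    push_cast
    have e : (y g : A) - (y b + y c) = p * (g - (b + c)) * p - (p * g * p - y g)
        + ((p * b * p - y b) + (p * c * p - y c)) := by noncomm_ring
    rw [e]
    have h1 := norm_add_le (p * (g - (b + c)) * p - (p * g * p - y g))
      ((p * b * p - y b) + (p * c * p - y c))
    have h2 := norm_sub_le (p * (g - (b + c)) * p) (p * g * p - y g)
    have h3 := norm_add_le (p * b * p - y b) (p * c * p - y c)
    linarith [hcompress (g - (b + c)), hy g hg, hy b hb, hy c hc]
  · rw [← map_smul, ← map_sub]
    refine (hπle _).trans ?_
    push_cast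
    have e : (y g : A) - r • (y b : A) = p * (g - r • b) * p - (p * g * p - y g)
        + r • (p * b * p - y b) := by
      simp only [mul_sub, sub_mul, smul_sub, mul_smul_comm, smul_mul_assoc]
      abel
    rw [e]
    have h1 := norm_add_le (p * (g - r • b) * p - (p * g * p - y g)) (r • (p * b * p - y b))
    have h2 := norm_sub_le (p * (g - r • b) * p) (p * g * p - y g)
    rw [norm_smul] at h1
    have h3 : ‖r‖ * ‖p * b * p - y b‖ ≤ ‖r‖ * δ := by gcongr; exact hy b hb
    have h4 : (1 + ‖r‖) * δ ≤ (1 + ‖r‖) * ε := by gcongr; linarith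
    linarith [hcompress (g - r • b), hy g hg]
  · rw [← map_star, ← map_sub]
    refine (hπle _).trans ?_
    change ‖(y g : A) - star (y b : A)‖ ≤ _
    have e : (y g : A) - star (y b : A) = p * (g - star b) * p - (p * g * p - y g)
        + star (p * b * p - y b) := by
      simp only [star_sub, star_mul, hp.isSelfAdjoint.star_eq]
      noncomm_ring
    rw [e]
    have h1 := norm_add_le (p * (g - star b) * p - (p * g * p - y g)) (star (p * b * p - y b))
    have h2 := norm_sub_le (p * (g - star b) * p) (p * g * p - y g)
    rw [norm_star] at h1
    linarith [hcompress (g - star b), hy g hg, hy b hb]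
  · rw [← map_mul, ← map_sub]
    refine (hπle _).trans ?_
    push_cast
    have := norm_sub_mul_le_of_compress hp (hC b hb) (hC c hc) hδ1
      (hcomm c (Finset.mem_insert_of_mem hc)).le (hy b hb) (hy c hc) (hy g hg)
    linarith
  · rw [← map_sub]
    have h0 : ‖((y g₀ : A) - y b₀)‖ - δ < ‖π (y g₀ - y b₀)‖ := hπ
    have e : p * (g₀ - b₀) * p = ((y g₀ : A) - y b₀) + (p * g₀ * p - y g₀)
        - (p * b₀ * p - y b₀) := by noncomm_ring
    have h1 := norm_sub_le (((y g₀ : A) - y b₀) + (p * g₀ * p - y g₀)) (p * b₀ * p - y b₀)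
    have h2 := norm_add_le ((y g₀ : A) - y b₀) (p * g₀ * p - y g₀)
    rw [e] at hlow
    linarith [hy g₀ hg₀, hy b₀ hb₀]

/-- One coordinate for each pair of distinct points of `G`. In the supremum norm upper estimates
hold if they hold in every coordinate, while a lower estimate needs just the coordinate of its pair.
-/
theorem IsTAI.exists_isApproxHom {A : Type*} [CStarAlgebra A] [PartialOrder A]
    [StarOrderedRing A] (hA : IsTAI A) (G : Finset A) {ε : ℝ} (hε : 0 < ε) :
    ∃ (B : Type) (_ : NonUnitalCStarAlgebra B) (_ : FiniteDimensional ℂ B) (ψ : A → B),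
      IsApproxHom ψ G ε := by
  classical
  have key := fun i : Fin G.offDiag.card =>
    have hi := Finset.mem_offDiag.mp (G.offDiag.equivFin.symm i).2
    hA.exists_isApproxContraction G hi.1 hi.2.1 hi.2.2 hε
  choose B _ _ ψ hψ hlow using key
  refine ⟨∀ i, B i, inferInstance, inferInstance, fun a i => ψ i a,
    { toIsApproxContraction := .pi hε.le hψ
      sub_le := fun g hg b hb => ?_ }⟩
  rcases eq_or_ne g b with rfl | hne
  · simpa using hε.le
  · have h := hlow (G.offDiag.equivFin ⟨(g, b), Finset.mem_offDiag.mpr ⟨hg, hb, hne⟩⟩)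
    rw [Equiv.symm_apply_apply] at h
    refine h.trans (add_le_add_left ?_ ε)
    exact norm_le_pi_norm ((fun i => ψ i g) - fun i => ψ i b) _

theorem theorem4p1 {A : Type*} [CStarAlgebra A] [PartialOrder A] [StarOrderedRing A]
    [TopologicalSpace.SeparableSpace A] (hsimple : IsSimpleCStarAlgebra A) (hTAI : IsTAI A) :
    IsMF A :=
  isMF_of_exists_isApproxHom fun G _ hε => hTAI.exists_isApproxHom G hε
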